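/- Let $d\ge 1$ and let $\Omega\subset\mathbb{R}^d$ be an open set of finite Lebesgue measure $|\Omega|$. Write $\widehat\varphi(\xi)=\int_{\mathbb{R}^d}e^{-ix\cdot\xi}\varphi(x)\,dx$, identify $L^2(\Omega)$ with the space of complex-valued functions in $L^2(\mathbb{R}^d)$ that vanish almost everywhere outside $\Omega$, and let $\mathbb{H}(\Omega)\subset L^2(\Omega)$ be the closure of $C_c^\infty(\Omega)$ with respect to the norm given by $\|\varphi\|_*^2=\int_{\mathbb{R}^d}\log(e+|\xi|)\,|\widehat\varphi(\xi)|^2\,d\xi$. Let $\mathcal{H}=\tfrac12\log(-\Delta)$ be the operator in $L^2(\Omega)$ associated with the form $$(\varphi,\psi)_{\log}=\frac{1}{(2\pi)^d}\int_{\mathbb{R}^d}\log|\xi|\;\widehat\varphi(\xi)\,\overline{\widehat\psi(\xi)}\,d\xi,\qquad \varphi,\psi\in\mathbb{H}(\Omega).$$ Thus $\mu\in\mathbb{R}$ is an eigenvalue of $\mathcal{H}$ if there is a nonzero $\varphi\in\mathbb{H}(\Omega)$ with $(\varphi,\psi)_{\log}=\mu\int_\Omega\varphi\,\overline{\psi}\,dx$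 for all $\psi\in\mathbb{H}(\Omega)$, and its multiplicity is the largest number of linearly independent such $\varphi$. For $\lambda\in\mathbb{R}$ let $N(\lambda)$ be the number of eigenvalues $\mu<\lambda$ of $\mathcal{H}$, counted with multiplicity. Then $N(\lambda)$ is finite for every $\lambda\in\mathbb{R}$, and $$N(\lambda)\le e^{d\lambda+1}\,\frac{1}{(2\pi)^d}\,|\Omega|\,|B_d|,$$ where $|B_d|$ is the Lebesgue measure of the unit ball $B_d$ of $\mathbb{R}^d$. -/

import Mathlib

open MeasureTheory
open scoped ENNReal ContDiff ComplexConjugate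

namespace LogLaplacian

/-- The Euclidean space `ℝ^d`. -/
abbrev Space (d : ℕ) : Type := EuclideanSpace ℝ (Fin d)

/-- The Hilbert space `L²(ℝ^d)` of complex-valued functions. -/
abbrev L2 (d : ℕ) : Type := Lp ℂ 2 (volume : Measure (Space d))

/-- The Fourier transform `f̂(ξ) = ∫ e^{-i x·ξ} f(x) dx`. It is only applied to functions that are
in `L²` and vanish a.e. outside a set of finite measure, so the integral converges absolutely. -/
noncomputable def fourierHat {d : ℕ} (f : Space d → ℂ) (ξ : Space d) : ℂ :=
  ∫ x : Space d, Complex.exp (-(Complex.I * ((inner ℝ x ξ : ℝ) : ℂ))) * f x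

/-- The squared norm `‖f‖_*² = ∫ log(e + |ξ|) |f̂(ξ)|² dξ`, as an extended nonnegative real. -/
noncomputable def starNormSq {d : ℕ} (f : Space d → ℂ) : ℝ≥0∞ :=
  ∫⁻ ξ : Space d, ENNReal.ofReal (Real.log (Real.exp 1 + ‖ξ‖)) * ‖fourierHat f ξ‖ₑ ^ 2

/-- `φ ∈ C_c^∞(Ω)`. -/
def IsTestFunction {d : ℕ} (Ω : Set (Space d)) (φ : Space d → ℂ) : Prop :=
  ContDiff ℝ ∞ φ ∧ HasCompactSupport φ ∧ tsupport φ ⊆ Ω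

/-- `L²(Ω)`, as the set of functions in `L²(ℝ^d)` that vanish a.e. outside `Ω`. -/
def L2On {d : ℕ} (Ω : Set (Space d)) : Set (L2 d) :=
  {u | ∀ᵐ x : Space d, x ∉ Ω → u x = 0}

/-- The form domain `ℍ(Ω)`: the closure of `C_c^∞(Ω)` with respect to `‖·‖_*`. Since
`(2π)^d ‖·‖_{L²}² ≤ ‖·‖_*²`, its elements are functions in `L²(Ω)`. -/
def formDomain {d : ℕ} (Ω : Set (Space d)) : Set (L2 d) :=
  {u | u ∈ L2On Ω ∧ ∀ ε : ℝ≥0∞, 0 < ε →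
    ∃ φ : Space d → ℂ, IsTestFunction Ω φ ∧ starNormSq (fun x => u x - φ x) < ε}

/-- The sesquilinear form `(u, v)_log = (2π)^{-d} ∫ log|ξ| û(ξ) conj(v̂(ξ)) dξ`. -/
noncomputable def logForm {d : ℕ} (u v : L2 d) : ℂ :=
  ((((2 * Real.pi) ^ d)⁻¹ : ℝ) : ℂ) *
    ∫ ξ : Space d, (Real.log ‖ξ‖ : ℂ) * (fourierHat u ξ * conj (fourierHat v ξ))

/-- `u` is a weak solution of `H u = μ u` in `Ω`, `u = 0` outside `Ω`, where `H` is the operator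
associated with the form `(·,·)_log` on `ℍ(Ω)`. -/
def IsWeakSolution {d : ℕ} (Ω : Set (Space d)) (μ : ℝ) (u : L2 d) : Prop :=
  u ∈ formDomain Ω ∧
    ∀ ψ ∈ formDomain Ω, logForm u ψ = (μ : ℂ) * ∫ x in Ω, u x * conj (ψ x)

/-- The eigenspace of `H` for the real number `μ`, i.e. the span of all weak solutions of
`H u = μ u`; it is zero if `μ` is not an eigenvalue. -/
noncomputable def eigenspace {d : ℕ} (Ω : Set (Space d)) (μ : ℝ) : Submodule ℂ (L2 d) :=
  Submodule.span ℂ {u | IsWeakSolution Ω μ u}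

/-- The multiplicity of `μ` as an eigenvalue of `H`: the largest number of linearly independent
eigenfunctions (`∞` if there is no largest number, `0` if `μ` is not an eigenvalue). -/
noncomputable def multiplicity {d : ℕ} (Ω : Set (Space d)) (μ : ℝ) : ℕ∞ :=
  Cardinal.toENat (Module.rank ℂ (eigenspace Ω μ))

/-- The counting function `N(Λ)`: the number of eigenvalues of `H` that are strictly below `Λ`,
counted with multiplicity, as an extended nonnegative real. -/
noncomputable def counting {d : ℕ} (Ω : Set (Space d)) (Λ : ℝ) : ℝ≥0∞ :=
  ∑' μ : Set.Iio Λ, (multiplicity Ω (μ : ℝ) : ℝ≥0∞)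

end LogLaplacian

namespace LogLaplacian

open Filter Topology FourierTransform

variable {d : ℕ} {Ω : Set (Space d)}

/-! This is a Berezin–Li–Yau argument. Let `u i` be orthonormal eigenfunctions with eigenvalues `μ i
< Λ`. By Plancherel and the weak equation tested with `u i` itself, `(2π)^d ∑ (b - μ i)` equals `∫
(b - log|ξ|) ∑ |û_i|²`. Since `û_i(ξ)` is the inner product of `u i` with the plane wave `e^{ix·ξ}`
on `Ω`, whose squared norm is `|Ω|`, Bessel gives `∑ |û_i(ξ)|² ≤ |Ω|` (`sum_norm_fourierHat_sq_le`).
So the integral is at most `|Ω| ∫ (b - log|ξ|)₊ ≤ |Ω| |B_d| e^{db}/d`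
(`integral_posPart_sub_log_le`). With `b = Λ + 1/d` every summand `b - μ i` is at least `1/d`, which
bounds the number of `u i` (`card_le_of_orthonormal`).

The bound makes eigenspaces finite-dimensional; since they are mutually orthogonal, their
orthonormal bases combine into one admissible family. -/

/-! ### Fourier transform on `L¹ ∩ L²` and Plancherel. -/

theorem fourierHat_eq_fourier (f : Space d → ℂ) (ξ : Space d) :
    fourierHat f ξ = 𝓕 f ((2 * Real.pi)⁻¹ • ξ) := by
  rw [Real.fourier_eq', fourierHat]
  congr 1 with x
  rw [smul_eq_mul]
  congr 2
  rw [inner_smul_right]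
  have : (Real.pi : ℂ) ≠ 0 := by exact_mod_cast Real.pi_ne_zero
  push_cast
  field_simp

theorem continuous_fourier_of_integrable {f : Space d → ℂ} (hf : Integrable f) :
    Continuous (𝓕 f) :=
  VectorFourier.fourierIntegral_continuous Real.continuous_fourierChar
    (by exact continuous_inner) hf

theorem continuous_fourierHat {f : Space d → ℂ} (hf : Integrable f) :
    Continuous (fourierHat f) := by
  have : fourierHat f = fun ξ => 𝓕 f ((2 * Real.pi)⁻¹ • ξ) := funext (fourierHat_eq_fourier f)
  rw [this]
  exact (continuous_fourier_of_integrable hf).comp (continuous_const_smul _)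

theorem fourierHat_congr_ae {f g : Space d → ℂ} (h : f =ᵐ[volume] g) :
    fourierHat f = fourierHat g := by
  funext ξ
  refine integral_congr_ae ?_
  filter_upwards [h] with x hx
  rw [hx]

theorem integrable_exp_mul {f : Space d → ℂ} (hf : Integrable f) (ξ : Space d) :
    Integrable fun x => Complex.exp (-(Complex.I * ((inner ℝ x ξ : ℝ) : ℂ))) * f x := by
  refine hf.bdd_mul (c := 1) ?_ ?_
  · exact Continuous.aestronglyMeasurable (by fun_prop)
  · refine .of_forall fun x => ?_
    rw [Complex.norm_exp]
    simp

theorem fourierHat_add {f g : Space d → ℂ} (hf : Integrable f) (hg : Integrable g)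
    (ξ : Space d) : fourierHat (fun x => f x + g x) ξ = fourierHat f ξ + fourierHat g ξ := by
  simp only [fourierHat, mul_add]
  exact integral_add (integrable_exp_mul hf ξ) (integrable_exp_mul hg ξ)

theorem fourierHat_const_mul (c : ℂ) (f : Space d → ℂ) (ξ : Space d) :
    fourierHat (fun x => c * f x) ξ = c * fourierHat f ξ := by
  simp only [fourierHat, mul_left_comm _ c]
  exact integral_const_mul c _

theorem integrable_of_mem_L2On (hfin : volume Ω < ⊤) {u : L2 d}
    (hu : u ∈ L2On Ω) : Integrable u := by
  have : IsFiniteMeasure (volume.restrict Ω) := ⟨by simpa using hfin⟩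
  have h : IntegrableOn u Ω := ((Lp.memLp u).restrict Ω).integrable (by norm_num)
  exact h.integrable_of_ae_notMem_eq_zero hu

/-- On `L¹ ∩ L²` the `L²` Fourier transform is given by the Fourier integral. -/
theorem coeFn_fourier_ae_eq (u : L2 d) (hu : Integrable u) :
    (𝓕 u : L2 d) =ᵐ[volume] 𝓕 (u : Space d → ℂ) := by
  refine ae_eq_of_integral_contDiff_smul_eq
    ((Lp.memLp (𝓕 u : L2 d)).locallyIntegrable (by norm_num))
    (continuous_fourier_of_integrable hu).locallyIntegrable fun g hg hgs => ?_
  have hg' : ContDiff ℝ ∞ (fun x => (g x : ℂ)) := Complex.ofRealCLM.contDiff.comp hg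
  have hgs' : HasCompactSupport (fun x => (g x : ℂ)) := hgs.comp_left (g := Complex.ofReal) rfl
  set G : SchwartzMap (Space d) ℂ := hgs'.toSchwartzMap hg' with hG
  have hGc : ∀ x, G x = (g x : ℂ) := fun x => rfl
  -- Both transforms are moved onto the Schwartz function `G` by duality: `h1` distributionally,
  -- `h2` by Fubini.
  have h1 := DFunLike.congr_fun (Lp.fourier_toTemperedDistribution_eq u) G
  rw [TemperedDistribution.fourier_apply, Lp.toTemperedDistribution_apply,
    Lp.toTemperedDistribution_apply] at h1
  have h2 := VectorFourier.integral_fourierIntegral_smul_eq_flip (L := innerₗ (Space d))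
    (μ := volume) (ν := volume) (f := G) (g := u) Real.continuous_fourierChar
    (by exact continuous_inner) G.integrable hu
  rw [flip_innerₗ] at h2
  calc ∫ x, g x • (𝓕 u : L2 d) x = ∫ x, G x • (𝓕 u : L2 d) x := by
        simp [hGc]
    _ = ∫ x, (𝓕 G) x • u x := h1.symm
    _ = ∫ x, G x • 𝓕 (u : Space d → ℂ) x := h2
    _ = ∫ x, g x • 𝓕 (u : Space d → ℂ) x := by simp [hGc]

theorem finrank_space : Module.finrank ℝ (Space d) = d := by simp

theorem integrable_norm_sq (u : L2 d) : Integrable fun x => ‖u x‖ ^ 2 :=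
  (Lp.memLp u).integrable_norm_pow (by norm_num)

theorem integral_norm_sq (u : L2 d) : ∫ x, ‖u x‖ ^ 2 = ‖u‖ ^ 2 := by
  have h := @inner_self_eq_norm_sq_to_K ℂ (L2 d) _ _ _ u
  rw [L2.inner_def] at h
  have h2 : ∫ x, inner ℂ (u x) (u x) = ((∫ x, ‖u x‖ ^ 2 : ℝ) : ℂ) := by
    rw [← integral_complex_ofReal]
    congr 1 with x
    rw [inner_self_eq_norm_sq_to_K]
    simp
  rw [h2] at h
  exact Complex.ofReal_injective (by simpa using h)

theorem integrable_norm_fourierHat_sq (u : L2 d) (hu : Integrable u) :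
    Integrable fun ξ => ‖fourierHat u ξ‖ ^ 2 := by
  have h : Integrable fun ξ => ‖𝓕 (u : Space d → ℂ) ξ‖ ^ 2 := by
    refine (integrable_norm_sq (𝓕 u : L2 d)).congr ?_
    filter_upwards [coeFn_fourier_ae_eq u hu] with x hx
    rw [hx]
  simp only [fourierHat_eq_fourier]
  exact (integrable_comp_smul_iff volume _ (by positivity)).2 h

/-- Plancherel's identity for the unnormalised Fourier transform. -/
theorem integral_norm_fourierHat_sq (u : L2 d) (hu : Integrable u) :
    ∫ ξ, ‖fourierHat u ξ‖ ^ 2 = (2 * Real.pi) ^ d * ‖u‖ ^ 2 := by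
  have h : ∫ ξ, ‖𝓕 (u : Space d → ℂ) ξ‖ ^ 2 = ‖u‖ ^ 2 := by
    rw [← Lp.norm_fourier_eq u, ← integral_norm_sq (𝓕 u : L2 d)]
    refine integral_congr_ae ?_
    filter_upwards [coeFn_fourier_ae_eq u hu] with x hx
    rw [hx]
  simp only [fourierHat_eq_fourier]
  rw [Measure.integral_comp_smul volume (fun ξ => ‖𝓕 (u : Space d → ℂ) ξ‖ ^ 2), h,
    finrank_space, abs_of_pos (by positivity), smul_eq_mul, inv_pow, inv_inv]

/-! ### The integral of `(b - log|ξ|)₊`. -/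

theorem max_sub_log_nonneg (b : ℝ) :
    0 ≤ᵐ[volume] fun ξ : Space d => max (b - Real.log ‖ξ‖) 0 :=
  .of_forall fun _ => le_max_right _ _

/-- Layer-cake computation of `∫ (b - log|ξ|)₊ dξ`. -/
theorem lintegral_posPart_sub_log_le (hd : 1 ≤ d) (b : ℝ) :
    ∫⁻ ξ : Space d, ENNReal.ofReal (max (b - Real.log ‖ξ‖) 0) ≤
      volume (Metric.ball (0 : Space d) 1) * ENNReal.ofReal (Real.exp (d * b) / d) := by
  have : Nonempty (Fin d) := ⟨⟨0, hd⟩⟩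
  have hd0 : (0 : ℝ) < d := by exact_mod_cast hd
  rw [lintegral_eq_lintegral_meas_lt volume (max_sub_log_nonneg b)
    (by fun_prop)]
  have hball : ∀ t : ℝ, 0 < t → volume {ξ : Space d | t < max (b - Real.log ‖ξ‖) 0} ≤
      ENNReal.ofReal (Real.exp (d * b) * Real.exp (-d * t)) *
        volume (Metric.ball (0 : Space d) 1) := by
    intro t ht
    -- The origin is treated apart because `Real.log 0 = 0`; it lies in the ball anyway.
    have hsub : {ξ : Space d | t < max (b - Real.log ‖ξ‖) 0} ⊆
        insert 0 (Metric.ball (0 : Space d) (Real.exp (b - t))) := by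
      intro ξ hξ
      rcases eq_or_ne ξ 0 with rfl | h0
      · exact Set.mem_insert _ _
      · refine Set.mem_insert_of_mem _ ?_
        have : t < b - Real.log ‖ξ‖ := (lt_max_iff.1 hξ).resolve_right ht.not_gt
        rw [mem_ball_zero_iff, ← Real.log_lt_iff_lt_exp (norm_pos_iff.2 h0)]
        linarith
    refine (measure_mono hsub).trans ?_
    rw [Set.insert_eq_of_mem (by simp [Real.exp_pos]),
      Measure.addHaar_ball volume _ (Real.exp_pos _).le, finrank_space, ← Real.exp_nat_mul,
      ← Real.exp_add]
    refine le_of_eq ?_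
    ring_nf
  have hint : IntegrableOn (fun t : ℝ => Real.exp (d * b) * Real.exp (-d * t)) (Set.Ioi 0) :=
    (integrableOn_exp_mul_Ioi (by linarith) 0).const_mul _
  calc _ ≤ ∫⁻ t in Set.Ioi (0 : ℝ), ENNReal.ofReal (Real.exp (d * b) * Real.exp (-d * t)) *
        volume (Metric.ball (0 : Space d) 1) :=
      setLIntegral_mono' measurableSet_Ioi fun t ht => hball t ht
    _ = _ := by
      rw [lintegral_mul_const _ (by fun_prop), mul_comm,
        ← ofReal_integral_eq_lintegral_ofReal hint (.of_forall fun t => by positivity),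
        integral_const_mul, integral_exp_mul_Ioi (by linarith)]
      congr 2
      simp [div_eq_mul_inv]

theorem integrable_posPart_sub_log (hd : 1 ≤ d) (b : ℝ) :
    Integrable fun ξ : Space d => max (b - Real.log ‖ξ‖) 0 := by
  refine ⟨Measurable.aestronglyMeasurable (by fun_prop), ?_⟩
  rw [hasFiniteIntegral_iff_ofReal (max_sub_log_nonneg b)]
  exact (lintegral_posPart_sub_log_le hd b).trans_lt
    (ENNReal.mul_lt_top measure_ball_lt_top ENNReal.ofReal_lt_top)

theorem integral_posPart_sub_log_le (hd : 1 ≤ d) (b : ℝ) :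
    ∫ ξ : Space d, max (b - Real.log ‖ξ‖) 0 ≤
      volume.real (Metric.ball (0 : Space d) 1) * (Real.exp (d * b) / d) := by
  rw [integral_eq_lintegral_of_nonneg_ae (max_sub_log_nonneg b)
    (integrable_posPart_sub_log hd b).1]
  have := ENNReal.toReal_mono
    (ENNReal.mul_ne_top measure_ball_lt_top.ne ENNReal.ofReal_ne_top)
    (lintegral_posPart_sub_log_le hd b)
  rwa [ENNReal.toReal_mul, ENNReal.toReal_ofReal (by positivity)] at this

/-! ### The norm `‖·‖_*` and linearity of the form domain. -/

theorem log_exp_one_add_nonneg (r : ℝ) (hr : 0 ≤ r) : 0 ≤ Real.log (Real.exp 1 + r) :=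
  Real.log_nonneg (by linarith [Real.add_one_le_exp 1])

/-- The transform is Schwartz: one factor of `|φ̂|²` is bounded, and the other is integrable against
the crude weight `e + |ξ|`. -/
theorem starNormSq_testFunction_lt_top {φ : Space d → ℂ} (hφ : IsTestFunction Ω φ) :
    starNormSq φ < ⊤ := by
  set G : SchwartzMap (Space d) ℂ := hφ.2.1.toSchwartzMap hφ.1
  obtain ⟨M, hM⟩ : ∃ M, ∀ x, ‖(𝓕 G) x‖ ≤ M := by
    obtain ⟨M, -, hM⟩ := (𝓕 G).decay 0 0
    exact ⟨M, fun x => by simpa using hM x⟩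
  have h0 : Integrable fun x : Space d =>
      M * (Real.exp 1 * ‖(𝓕 G) x‖ + 2 * Real.pi * (‖x‖ ^ 1 * ‖(𝓕 G) x‖)) :=
    (((𝓕 G).integrable.norm.const_mul _).add
      (((𝓕 G).integrable_pow_mul volume 1).const_mul _)).const_mul _
  have h1 := (integrable_comp_smul_iff volume _
    (R := (2 * Real.pi)⁻¹) (by positivity)).2 h0
  refine lt_of_le_of_lt (lintegral_mono fun ξ => ?_) h1.lintegral_lt_top
  have hhat : fourierHat φ ξ = (𝓕 G) ((2 * Real.pi)⁻¹ • ξ) := fourierHat_eq_fourier φ ξ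
  rw [hhat, ← ofReal_norm, ← ENNReal.ofReal_pow (norm_nonneg _),
    ← ENNReal.ofReal_mul (log_exp_one_add_nonneg _ (norm_nonneg _))]
  refine ENNReal.ofReal_le_ofReal ?_
  have hn : 2 * Real.pi * ‖(2 * Real.pi)⁻¹ • ξ‖ = ‖ξ‖ := by
    rw [norm_smul, Real.norm_of_nonneg (by positivity)]
    field_simp
  have hlog : Real.log (Real.exp 1 + ‖ξ‖) ≤ Real.exp 1 + ‖ξ‖ :=
    Real.log_le_self (by positivity)
  generalize (2 * Real.pi)⁻¹ • ξ = η at hn ⊢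
  have hz := hM η
  have hz0 := norm_nonneg ((𝓕 G) η)
  generalize ‖(𝓕 G) η‖ = z at hz hz0 ⊢
  calc Real.log (Real.exp 1 + ‖ξ‖) * z ^ 2 ≤ (Real.exp 1 + ‖ξ‖) * (M * z) := by
          rw [sq]; gcongr
      _ = _ := by rw [← hn]; ring

theorem starNormSq_add_le {f g : Space d → ℂ} (hf : Integrable f) (hg : Integrable g) :
    starNormSq (fun x => f x + g x) ≤ 2 * starNormSq f + 2 * starNormSq g := by
  have hmeas : ∀ {f : Space d → ℂ}, Integrable f → Measurable fun ξ : Space d =>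
      ENNReal.ofReal (Real.log (Real.exp 1 + ‖ξ‖)) * ‖fourierHat f ξ‖ₑ ^ 2 := fun hf =>
    Measurable.mul (by fun_prop) ((continuous_fourierHat hf).measurable.enorm.pow_const 2)
  unfold starNormSq
  rw [← lintegral_const_mul _ (hmeas hf), ← lintegral_const_mul _ (hmeas hg),
    ← lintegral_add_left ((hmeas hf).const_mul _)]
  refine lintegral_mono fun ξ => ?_
  rw [fourierHat_add hf hg]
  calc _ ≤ ENNReal.ofReal (Real.log (Real.exp 1 + ‖ξ‖)) *
        (2 * (‖fourierHat f ξ‖ₑ ^ 2 + ‖fourierHat g ξ‖ₑ ^ 2)) := by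
        gcongr
        rw [← ofReal_norm, ← ofReal_norm, ← ofReal_norm, ← ENNReal.ofReal_pow (norm_nonneg _),
          ← ENNReal.ofReal_pow (norm_nonneg _), ← ENNReal.ofReal_pow (norm_nonneg _),
          ← ENNReal.ofReal_add (by positivity) (by positivity),
          show (2 : ℝ≥0∞) = ENNReal.ofReal 2 by simp, ← ENNReal.ofReal_mul (by norm_num)]
        refine ENNReal.ofReal_le_ofReal ?_
        calc _ ≤ (‖fourierHat f ξ‖ + ‖fourierHat g ξ‖) ^ 2 := by gcongr; exact norm_add_le _ _
          _ ≤ _ := by linarith [sq_nonneg (‖fourierHat f ξ‖ - ‖fourierHat g ξ‖)]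
    _ = _ := by ring

theorem starNormSq_const_mul (c : ℂ) (f : Space d → ℂ) :
    starNormSq (fun x => c * f x) = ‖c‖ₑ ^ 2 * starNormSq f := by
  unfold starNormSq
  rw [← lintegral_const_mul' _ _ (by finiteness)]
  congr 1 with ξ
  rw [fourierHat_const_mul, enorm_mul]
  ring

theorem starNormSq_congr_ae {f g : Space d → ℂ} (h : f =ᵐ[volume] g) :
    starNormSq f = starNormSq g := by
  unfold starNormSq
  rw [fourierHat_congr_ae h]

theorem IsTestFunction.integrable {φ : Space d → ℂ} (hφ : IsTestFunction Ω φ) :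
    Integrable φ :=
  hφ.1.continuous.integrable_of_hasCompactSupport hφ.2.1

theorem integrable_of_mem_formDomain (hfin : volume Ω < ⊤) {u : L2 d}
    (hu : u ∈ formDomain Ω) : Integrable u :=
  integrable_of_mem_L2On hfin hu.1

theorem starNormSq_lt_top_of_mem_formDomain (hfin : volume Ω < ⊤) {u : L2 d}
    (hu : u ∈ formDomain Ω) : starNormSq u < ⊤ := by
  have hi := integrable_of_mem_formDomain hfin hu
  obtain ⟨φ, hφ, h⟩ := hu.2 1 one_pos
  have h2 := starNormSq_add_le (hi.sub hφ.integrable) hφ.integrable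
  simp only [Pi.sub_apply, sub_add_cancel] at h2
  refine h2.trans_lt (ENNReal.add_lt_top.2 ⟨?_, ?_⟩)
  · exact ENNReal.mul_lt_top (by simp) (h.trans ENNReal.one_lt_top)
  · exact ENNReal.mul_lt_top (by simp) (starNormSq_testFunction_lt_top hφ)

theorem add_mem_formDomain (hfin : volume Ω < ⊤) {u v : L2 d} (hu : u ∈ formDomain Ω)
    (hv : v ∈ formDomain Ω) : u + v ∈ formDomain Ω := by
  have hui := integrable_of_mem_formDomain hfin hu
  have hvi := integrable_of_mem_formDomain hfin hv
  refine ⟨?_, fun ε hε => ?_⟩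
  · have h1 := hu.1
    have h2 := hv.1
    simp only [L2On, Set.mem_ofPred_eq] at h1 h2 ⊢
    filter_upwards [h1, h2, Lp.coeFn_add u v] with x h1 h2 h3 hx
    rw [h3, Pi.add_apply, h1 hx, h2 hx, add_zero]
  · have hε4 : 0 < ε / 4 := ENNReal.div_pos hε.ne' (by simp)
    obtain ⟨φ, hφ, hφu⟩ := hu.2 _ hε4
    obtain ⟨ψ, hψ, hψv⟩ := hv.2 _ hε4
    refine ⟨fun x => φ x + ψ x, ⟨hφ.1.add hψ.1, hφ.2.1.add hψ.2.1, ?_⟩, ?_⟩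
    · exact (tsupport_add φ ψ).trans (Set.union_subset hφ.2.2 hψ.2.2)
    · have he : (fun x => (u + v : L2 d) x - (φ x + ψ x)) =ᵐ[volume]
          fun x => (u x - φ x) + (v x - ψ x) := by
        filter_upwards [Lp.coeFn_add u v] with x h3
        rw [h3, Pi.add_apply]
        ring
      rw [starNormSq_congr_ae he]
      calc _ ≤ 2 * starNormSq (fun x => u x - φ x) + 2 * starNormSq (fun x => v x - ψ x) :=
            starNormSq_add_le (hui.sub hφ.integrable) (hvi.sub hψ.integrable)
        _ < 2 * (ε / 4) + 2 * (ε / 4) :=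
          ENNReal.add_lt_add (ENNReal.mul_lt_mul_right (by simp) (by simp) hφu)
            (ENNReal.mul_lt_mul_right (by simp) (by simp) hψv)
        _ = 4 * (ε / 4) := by ring
        _ = ε := ENNReal.mul_div_cancel (by simp) (by simp)

theorem smul_mem_formDomain (c : ℂ) {u : L2 d} (hu : u ∈ formDomain Ω) :
    c • u ∈ formDomain Ω := by
  refine ⟨?_, fun ε hε => ?_⟩
  · have h1 := hu.1
    simp only [L2On, Set.mem_ofPred_eq] at h1 ⊢
    filter_upwards [h1, Lp.coeFn_smul c u] with x h1 h3 hx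
    rw [h3, Pi.smul_apply, h1 hx, smul_zero]
  -- The summand `1` keeps the divisor nonzero when `c = 0`.
  · have hc : ‖c‖ₑ ^ 2 + 1 ≠ ⊤ := by finiteness
    obtain ⟨φ, hφ, hφu⟩ := hu.2 (ε / (‖c‖ₑ ^ 2 + 1)) (ENNReal.div_pos hε.ne' hc)
    refine ⟨fun x => c * φ x, ⟨contDiff_const.mul hφ.1, hφ.2.1.mul_left, ?_⟩, ?_⟩
    · exact (tsupport_mul_subset_right (f := fun _ => c)).trans hφ.2.2
    · have he : (fun x => (c • u : L2 d) x - c * φ x) =ᵐ[volume]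
          fun x => c * (u x - φ x) := by
        filter_upwards [Lp.coeFn_smul c u] with x h3
        rw [h3, Pi.smul_apply, smul_eq_mul]
        ring
      rw [starNormSq_congr_ae he, starNormSq_const_mul]
      calc _ ≤ (‖c‖ₑ ^ 2 + 1) * starNormSq (fun x => u x - φ x) := by gcongr; simp
        _ < (‖c‖ₑ ^ 2 + 1) * (ε / (‖c‖ₑ ^ 2 + 1)) :=
          ENNReal.mul_lt_mul_right (by simp) hc hφu
        _ = ε := ENNReal.mul_div_cancel (by simp) hc

theorem zero_mem_formDomain : (0 : L2 d) ∈ formDomain Ω := by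
  refine ⟨?_, fun ε hε => ⟨0, ⟨contDiff_const, HasCompactSupport.zero, by simp [tsupport]⟩, ?_⟩⟩
  · simp only [L2On, Set.mem_ofPred_eq]
    filter_upwards [Lp.coeFn_zero ℂ 2 (volume : Measure (Space d))] with x hx _
    rw [hx, Pi.zero_apply]
  -- Zero is written as a product so that the homogeneity lemma yields norm zero.
  · have he : (fun x => (0 : L2 d) x - (0 : Space d → ℂ) x) =ᵐ[volume] fun _ => 0 * 0 := by
      filter_upwards [Lp.coeFn_zero ℂ 2 (volume : Measure (Space d))] with x hx
      simp
    rw [starNormSq_congr_ae he, starNormSq_const_mul]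
    simpa using hε

/-! ### Plane waves and Bessel's inequality. -/

/-- The exponential `x ↦ e^{i x·ξ}` restricted to `Ω`, as an element of `L²`. -/
noncomputable def planeWave (hΩ : MeasurableSet Ω) (hfin : volume Ω < ⊤) (ξ : Space d) : L2 d :=
  MemLp.toLp (Ω.indicator fun x => Complex.exp (Complex.I * ((inner ℝ x ξ : ℝ) : ℂ))) <| by
    have : IsFiniteMeasure (volume.restrict Ω) := ⟨by simpa using hfin⟩
    refine (memLp_indicator_iff_restrict hΩ).2 (MemLp.of_bound ?_ 1 ?_)
    · exact Continuous.aestronglyMeasurable (by fun_prop)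
    · exact .of_forall fun x => by rw [Complex.norm_exp]; simp

theorem norm_planeWave_sq (hΩ : MeasurableSet Ω) (hfin : volume Ω < ⊤) (ξ : Space d) :
    ‖planeWave hΩ hfin ξ‖ ^ 2 = volume.real Ω := by
  rw [← integral_norm_sq, ← setIntegral_one_eq_measureReal, ← integral_indicator hΩ]
  refine integral_congr_ae ?_
  filter_upwards [MemLp.coeFn_toLp (f := Ω.indicator fun x : Space d =>
    Complex.exp (Complex.I * ((inner ℝ x ξ : ℝ) : ℂ))) (p := 2) (μ := volume) _] with x hx
  rw [planeWave, hx]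
  by_cases h : x ∈ Ω
  · simp [h, Complex.norm_exp]
  · simp [h]

theorem inner_planeWave (hΩ : MeasurableSet Ω) (hfin : volume Ω < ⊤) (ξ : Space d) {u : L2 d}
    (hu : u ∈ L2On Ω) : inner ℂ (planeWave hΩ hfin ξ) u = fourierHat u ξ := by
  rw [L2.inner_def, fourierHat]
  refine integral_congr_ae ?_
  filter_upwards [MemLp.coeFn_toLp (f := Ω.indicator fun x : Space d =>
    Complex.exp (Complex.I * ((inner ℝ x ξ : ℝ) : ℂ))) (p := 2) (μ := volume) _, hu] with x hx hux
  rw [planeWave, hx]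
  by_cases h : x ∈ Ω
  · simp [h, ← Complex.exp_conj, mul_comm]
  · simp [h, hux h]

theorem norm_fourierHat_sq_le (hΩ : MeasurableSet Ω) (hfin : volume Ω < ⊤) {u : L2 d}
    (hu : u ∈ L2On Ω) (ξ : Space d) : ‖fourierHat u ξ‖ ^ 2 ≤ volume.real Ω * ‖u‖ ^ 2 := by
  rw [← inner_planeWave hΩ hfin ξ hu, ← norm_planeWave_sq hΩ hfin ξ, ← mul_pow]
  gcongr
  exact norm_inner_le_norm _ _

theorem sum_norm_fourierHat_sq_le (hΩ : MeasurableSet Ω) (hfin : volume Ω < ⊤) {ι : Type*}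
    [Fintype ι] {u : ι → L2 d} (hu : ∀ i, u i ∈ L2On Ω) (ho : Orthonormal ℂ u) (ξ : Space d) :
    ∑ i, ‖fourierHat (u i) ξ‖ ^ 2 ≤ volume.real Ω := by
  rw [← norm_planeWave_sq hΩ hfin ξ]
  refine le_trans (le_of_eq ?_) (ho.sum_inner_products_le (planeWave hΩ hfin ξ) (s := .univ))
  refine Finset.sum_congr rfl fun i _ => ?_
  rw [← inner_planeWave hΩ hfin ξ (hu i), norm_inner_symm]

/-! ### The logarithmic form on the form domain. -/

/-- Separates growth at infinity, controlled by `‖·‖_*`, from the singularity at the origin, which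
is integrable against the bounded function `|û|²`. -/
theorem abs_log_le (r : ℝ) (hr : 0 ≤ r) :
    |Real.log r| ≤ Real.log (Real.exp 1 + r) + max (0 - Real.log r) 0 := by
  have h := log_exp_one_add_nonneg r hr
  rcases le_total 0 (Real.log r) with h0 | h0
  · rw [abs_of_nonneg h0]
    rcases hr.eq_or_lt with rfl | hr'
    · simp
    · have := Real.log_le_log hr' (show r ≤ Real.exp 1 + r by linarith [Real.exp_pos 1])
      linarith [le_max_right (0 - Real.log r) 0]
  · rw [abs_of_nonpos h0]
    linarith [le_max_left (0 - Real.log r) 0]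

theorem integrable_log_mul_norm_sq (hd : 1 ≤ d) (hΩ : MeasurableSet Ω) (hfin : volume Ω < ⊤)
    {u : L2 d} (hu : u ∈ formDomain Ω) :
    Integrable fun ξ : Space d => |Real.log ‖ξ‖| * ‖fourierHat u ξ‖ ^ 2 := by
  have hui := integrable_of_mem_formDomain hfin hu
  have hc := continuous_fourierHat hui
  have h1 : Integrable fun ξ : Space d =>
      Real.log (Real.exp 1 + ‖ξ‖) * ‖fourierHat u ξ‖ ^ 2 := by
    refine ⟨Measurable.aestronglyMeasurable
      (Measurable.mul (by fun_prop) (hc.norm.pow 2).measurable), ?_⟩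
    rw [hasFiniteIntegral_iff_ofReal (.of_forall fun ξ => by
      exact mul_nonneg (log_exp_one_add_nonneg _ (norm_nonneg _)) (by positivity))]
    refine lt_of_eq_of_lt ?_ (starNormSq_lt_top_of_mem_formDomain hfin hu)
    refine lintegral_congr fun ξ => ?_
    rw [ENNReal.ofReal_mul (log_exp_one_add_nonneg _ (norm_nonneg _)),
      ENNReal.ofReal_pow (norm_nonneg _), ofReal_norm]
  refine (h1.add ((integrable_posPart_sub_log hd 0).const_mul
    (volume.real Ω * ‖u‖ ^ 2))).mono' ?_ (.of_forall fun ξ => ?_)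
  · exact Measurable.aestronglyMeasurable
      (Measurable.mul (by fun_prop) (hc.norm.pow 2).measurable)
  · rw [Real.norm_of_nonneg (by positivity), Pi.add_apply]
    have := norm_fourierHat_sq_le hΩ hfin hu.1 ξ
    calc _ ≤ (Real.log (Real.exp 1 + ‖ξ‖) + max (0 - Real.log ‖ξ‖) 0) *
          ‖fourierHat u ξ‖ ^ 2 := by gcongr; exact abs_log_le _ (norm_nonneg _)
      _ ≤ _ := by
        rw [add_mul, mul_comm (max _ _)]
        gcongr

theorem integrable_logForm (hd : 1 ≤ d) (hΩ : MeasurableSet Ω) (hfin : volume Ω < ⊤)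
    {u v : L2 d} (hu : u ∈ formDomain Ω) (hv : v ∈ formDomain Ω) :
    Integrable fun ξ : Space d =>
      (Real.log ‖ξ‖ : ℂ) * (fourierHat u ξ * conj (fourierHat v ξ)) := by
  have huc := continuous_fourierHat (integrable_of_mem_formDomain hfin hu)
  have hvc := continuous_fourierHat (integrable_of_mem_formDomain hfin hv)
  refine ((integrable_log_mul_norm_sq hd hΩ hfin hu).add
    (integrable_log_mul_norm_sq hd hΩ hfin hv)).mono' ?_ (.of_forall fun ξ => ?_)
  · refine Measurable.aestronglyMeasurable (Measurable.mul ?_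
      (huc.mul (Complex.continuous_conj.comp hvc)).measurable)
    exact Complex.measurable_ofReal.comp (by fun_prop)
  · rw [norm_mul, norm_mul, RCLike.norm_conj, Complex.norm_real, Real.norm_eq_abs, Pi.add_apply,
      ← mul_add]
    gcongr
    nlinarith [sq_nonneg (‖fourierHat u ξ‖ - ‖fourierHat v ξ‖),
      sq_nonneg ‖fourierHat u ξ‖, sq_nonneg ‖fourierHat v ξ‖]

theorem fourierHat_coeFn_add {u v : L2 d} (hu : Integrable u) (hv : Integrable v)
    (ξ : Space d) : fourierHat (u + v : L2 d) ξ = fourierHat u ξ + fourierHat v ξ := by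
  rw [fourierHat_congr_ae (Lp.coeFn_add u v)]
  exact fourierHat_add hu hv ξ

theorem fourierHat_coeFn_smul (c : ℂ) (u : L2 d) (ξ : Space d) :
    fourierHat (c • u : L2 d) ξ = c * fourierHat u ξ := by
  rw [fourierHat_congr_ae (Lp.coeFn_smul c u)]
  exact fourierHat_const_mul c u ξ

theorem logForm_add_left (hd : 1 ≤ d) (hΩ : MeasurableSet Ω) (hfin : volume Ω < ⊤)
    {u v w : L2 d} (hu : u ∈ formDomain Ω) (hv : v ∈ formDomain Ω) (hw : w ∈ formDomain Ω) :
    logForm (u + v) w = logForm u w + logForm v w := by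
  unfold logForm
  rw [← mul_add, ← integral_add (integrable_logForm hd hΩ hfin hu hw)
    (integrable_logForm hd hΩ hfin hv hw)]
  congr 2 with ξ
  rw [fourierHat_coeFn_add (integrable_of_mem_formDomain hfin hu)
    (integrable_of_mem_formDomain hfin hv)]
  ring

theorem logForm_smul_left (c : ℂ) (u w : L2 d) : logForm (c • u) w = c * logForm u w := by
  unfold logForm
  rw [mul_left_comm, ← integral_const_mul c]
  congr 2 with ξ
  rw [fourierHat_coeFn_smul]
  ring

theorem conj_logForm (u v : L2 d) : conj (logForm u v) = logForm v u := by
  unfold logForm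
  rw [map_mul, Complex.conj_ofReal, ← integral_conj]
  congr 2 with ξ
  simp only [map_mul, Complex.conj_ofReal, Complex.conj_conj]
  ring

theorem logForm_self (u : L2 d) : logForm u u =
    ((((2 * Real.pi) ^ d)⁻¹ * ∫ ξ : Space d, Real.log ‖ξ‖ * ‖fourierHat u ξ‖ ^ 2 : ℝ) : ℂ) := by
  rw [logForm, Complex.ofReal_mul, ← integral_complex_ofReal]
  congr 2 with ξ
  rw [Complex.mul_conj, Complex.normSq_eq_norm_sq]
  push_cast
  rfl

/-! ### Weak solutions and eigenspaces. -/

theorem setIntegral_mul_conj {u : L2 d} (hu : u ∈ L2On Ω) (ψ : L2 d) :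
    ∫ x in Ω, u x * conj (ψ x) = inner ℂ ψ u := by
  rw [L2.inner_def, setIntegral_eq_integral_of_ae_compl_eq_zero]
  · rfl
  · filter_upwards [hu] with x hx hxΩ
    rw [hx hxΩ, zero_mul]

theorem isWeakSolution_iff {μ : ℝ} {u : L2 d} : IsWeakSolution Ω μ u ↔
    u ∈ formDomain Ω ∧ ∀ ψ ∈ formDomain Ω, logForm u ψ = (μ : ℂ) * inner ℂ ψ u := by
  unfold IsWeakSolution
  refine and_congr_right fun hu => forall₂_congr fun ψ _ => ?_
  rw [setIntegral_mul_conj hu.1]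

theorem isWeakSolution_of_mem_eigenspace (hd : 1 ≤ d) (hΩ : MeasurableSet Ω)
    (hfin : volume Ω < ⊤) {μ : ℝ} {u : L2 d} (hu : u ∈ eigenspace Ω μ) :
    IsWeakSolution Ω μ u := by
  refine Submodule.span_induction (p := fun u _ => IsWeakSolution Ω μ u)
    (fun x hx => hx) ?_ ?_ ?_ hu
  · refine isWeakSolution_iff.2 ⟨zero_mem_formDomain, fun ψ _ => ?_⟩
    have := logForm_smul_left 0 (0 : L2 d) ψ
    rw [zero_smul, zero_mul] at this
    rw [this, inner_zero_right, mul_zero]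
  · intro u v _ _ hu hv
    rw [isWeakSolution_iff] at hu hv ⊢
    refine ⟨add_mem_formDomain hfin hu.1 hv.1, fun ψ hψ => ?_⟩
    rw [logForm_add_left hd hΩ hfin hu.1 hv.1 hψ, hu.2 ψ hψ, hv.2 ψ hψ, inner_add_right, mul_add]
  · intro c u _ hu
    rw [isWeakSolution_iff] at hu ⊢
    refine ⟨smul_mem_formDomain c hu.1, fun ψ hψ => ?_⟩
    rw [logForm_smul_left, hu.2 ψ hψ, inner_smul_right, mul_left_comm]

/-- The form is Hermitian and the eigenvalues are real: testing each equation with the other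
solution gives `(μ - ν)⟨u, v⟩ = 0`. -/
theorem inner_eq_zero_of_isWeakSolution {μ ν : ℝ} (hne : μ ≠ ν) {u v : L2 d}
    (hu : IsWeakSolution Ω μ u) (hv : IsWeakSolution Ω ν v) : inner ℂ u v = 0 := by
  rw [isWeakSolution_iff] at hu hv
  have h1 := hu.2 v hv.1
  have h2 := hv.2 u hu.1
  rw [← conj_logForm, h1, map_mul, Complex.conj_ofReal, inner_conj_symm] at h2
  have h3 : ((μ : ℂ) - ν) * inner ℂ u v = 0 := by rw [sub_mul, h2, sub_self]
  exact (mul_eq_zero.1 h3).resolve_left (sub_ne_zero.2 (by exact_mod_cast hne))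

/-! ### The counting bound. -/

/-- The bound on the number of orthonormal eigenfunctions. -/
theorem card_le_of_orthonormal (hd : 1 ≤ d) (hΩ : MeasurableSet Ω) (hfin : volume Ω < ⊤)
    {Λ : ℝ} {ι : Type*} [Fintype ι] {u : ι → L2 d} {μ : ι → ℝ} (hμ : ∀ i, μ i < Λ)
    (hu : ∀ i, IsWeakSolution Ω (μ i) (u i)) (ho : Orthonormal ℂ u) :
    (Fintype.card ι : ℝ) ≤ Real.exp (d * Λ + 1) * ((2 * Real.pi) ^ d)⁻¹ * volume.real Ω *
      volume.real (Metric.ball (0 : Space d) 1) := by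
  have hd0 : (0 : ℝ) < d := by exact_mod_cast hd
  -- This choice minimises `e^{db} / (d(b - Λ))` over `b > Λ`, and produces the factor `e`.
  set b : ℝ := Λ + 1 / d with hb
  have hdom : ∀ i, u i ∈ formDomain Ω := fun i => (hu i).1
  have hui := fun i => integrable_of_mem_formDomain hfin (hdom i)
  have hint1 := fun i => integrable_norm_fourierHat_sq (u i) (hui i)
  have hint2 : ∀ i, Integrable fun ξ : Space d => Real.log ‖ξ‖ * ‖fourierHat (u i) ξ‖ ^ 2 := by
    intro i
    refine (integrable_log_mul_norm_sq hd hΩ hfin (hdom i)).mono' ?_ (.of_forall fun ξ => ?_)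
    · exact Measurable.aestronglyMeasurable (Measurable.mul (by fun_prop)
        ((continuous_fourierHat (hui i)).norm.pow 2).measurable)
    · simp
  have hint3 : ∀ i, Integrable fun ξ : Space d =>
      (b - Real.log ‖ξ‖) * ‖fourierHat (u i) ξ‖ ^ 2 := by
    intro i
    simp only [sub_mul]
    exact ((hint1 i).const_mul b).sub (hint2 i)
  have hlog : ∀ i, ∫ ξ : Space d, Real.log ‖ξ‖ * ‖fourierHat (u i) ξ‖ ^ 2 =
      (2 * Real.pi) ^ d * μ i := by
    intro i
    have h1 := (isWeakSolution_iff.1 (hu i)).2 (u i) (hdom i)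
    rw [logForm_self, inner_self_eq_norm_sq_to_K, ho.1 i] at h1
    have h2 : ((2 * Real.pi) ^ d)⁻¹ *
        ∫ ξ : Space d, Real.log ‖ξ‖ * ‖fourierHat (u i) ξ‖ ^ 2 = μ i :=
      Complex.ofReal_injective (by simpa using h1)
    rw [← h2, mul_inv_cancel_left₀ (by positivity)]
  have heach : ∀ i, ∫ ξ : Space d, (b - Real.log ‖ξ‖) * ‖fourierHat (u i) ξ‖ ^ 2 =
      (2 * Real.pi) ^ d * (b - μ i) := by
    intro i
    simp only [sub_mul]
    rw [integral_sub ((hint1 i).const_mul b) (hint2 i), integral_const_mul, hlog,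
      integral_norm_fourierHat_sq _ (hui i), ho.1 i]
    ring
  have hsum : (2 * Real.pi) ^ d * ∑ i, (b - μ i) ≤
      volume.real Ω * (volume.real (Metric.ball (0 : Space d) 1) * (Real.exp (d * b) / d)) := by
    calc _ = ∫ ξ : Space d, ∑ i, (b - Real.log ‖ξ‖) * ‖fourierHat (u i) ξ‖ ^ 2 := by
          rw [integral_finsetSum _ fun i _ => hint3 i, Finset.mul_sum]
          exact Finset.sum_congr rfl fun i _ => (heach i).symm
      _ ≤ ∫ ξ : Space d, volume.real Ω * max (b - Real.log ‖ξ‖) 0 := by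
          refine integral_mono (integrable_finsetSum _ fun i _ => hint3 i)
            ((integrable_posPart_sub_log hd b).const_mul _) fun ξ => ?_
          simp only [← Finset.mul_sum]
          -- The weight must be made nonnegative before the upper bound from Bessel can be inserted.
          calc _ ≤ max (b - Real.log ‖ξ‖) 0 * ∑ i, ‖fourierHat (u i) ξ‖ ^ 2 := by
                gcongr
                exact le_max_left _ _
            _ ≤ max (b - Real.log ‖ξ‖) 0 * volume.real Ω := by
                gcongr
                exact sum_norm_fourierHat_sq_le hΩ hfin (fun i => (hdom i).1) ho ξ
            _ = _ := mul_comm _ _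
      _ ≤ _ := by
          rw [integral_const_mul]
          gcongr
          exact integral_posPart_sub_log_le hd b
  have hcard : (Fintype.card ι : ℝ) * (1 / d) ≤ ∑ i, (b - μ i) := by
    have := Finset.card_nsmul_le_sum Finset.univ (fun i => b - μ i) (1 / d : ℝ) fun i _ => by
      have := hμ i
      linarith
    simpa using this
  have hdb : (d : ℝ) * b = d * Λ + 1 := by
    rw [hb]
    field_simp
  rw [hdb] at hsum
  have h2 : (2 * Real.pi) ^ d * ((Fintype.card ι : ℝ) * (1 / d)) ≤ _ :=
    (mul_le_mul_of_nonneg_left hcard (by positivity)).trans hsum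
  calc (Fintype.card ι : ℝ)
      = d * ((2 * Real.pi) ^ d)⁻¹ * ((2 * Real.pi) ^ d * ((Fintype.card ι : ℝ) * (1 / d))) := by
        field_simp
    _ ≤ d * ((2 * Real.pi) ^ d)⁻¹ * _ := mul_le_mul_of_nonneg_left h2 (by positivity)
    _ = _ := by field_simp

/-- Infinite rank would give more orthonormal eigenfunctions than the bound at level `μ + 1`
permits. -/
theorem finite_eigenspace (hd : 1 ≤ d) (hΩ : MeasurableSet Ω) (hfin : volume Ω < ⊤) (μ : ℝ) :
    Module.Finite ℂ (eigenspace Ω μ) := by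
  rw [← Module.rank_lt_aleph0_iff]
  by_contra! hinf
  obtain ⟨n, hn⟩ := exists_nat_gt (Real.exp (d * (μ + 1) + 1) * ((2 * Real.pi) ^ d)⁻¹ *
    volume.real Ω * volume.real (Metric.ball (0 : Space d) 1))
  obtain ⟨s, hs, hli⟩ := le_rank_iff_exists_linearIndependent_finset.1
    ((Cardinal.natCast_le_aleph0 (n := n)).trans hinf)
  have hcard : Module.finrank ℂ (Submodule.span ℂ (s : Set (eigenspace Ω μ))) = n := by
    rw [finrank_span_finset_eq_card hli, hs]
  let e := stdOrthonormalBasis ℂ (Submodule.span ℂ (s : Set (eigenspace Ω μ)))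
  have hle := card_le_of_orthonormal hd hΩ hfin (Λ := μ + 1)
    (u := fun i => ((e i : eigenspace Ω μ) : L2 d)) (μ := fun _ => μ) (fun _ => by linarith)
    (fun i => isWeakSolution_of_mem_eigenspace hd hΩ hfin (e i : eigenspace Ω μ).2)
    ((e.orthonormal.comp_linearIsometry (Submodule.subtypeₗᵢ _)).comp_linearIsometry
      (Submodule.subtypeₗᵢ _))
  rw [Fintype.card_fin, hcard] at hle
  exact hn.not_ge hle

theorem orthogonalFamily_eigenspace (hd : 1 ≤ d) (hΩ : MeasurableSet Ω) (hfin : volume Ω < ⊤)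
    {ι : Type*} {μ : ι → ℝ} (hμ : Function.Injective μ) :
    OrthogonalFamily ℂ (fun i => eigenspace Ω (μ i)) fun i => (eigenspace Ω (μ i)).subtypeₗᵢ :=
  fun _ _ hne x y => inner_eq_zero_of_isWeakSolution (hμ.ne hne)
    (isWeakSolution_of_mem_eigenspace hd hΩ hfin x.2)
    (isWeakSolution_of_mem_eigenspace hd hΩ hfin y.2)

theorem sum_finrank_eigenspace_le (hd : 1 ≤ d) (hΩ : MeasurableSet Ω) (hfin : volume Ω < ⊤)
    {Λ : ℝ} {ι : Type*} [Fintype ι] {μ : ι → ℝ} (hinj : Function.Injective μ)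
    (hμ : ∀ i, μ i < Λ) :
    ((∑ i, Module.finrank ℂ (eigenspace Ω (μ i)) : ℕ) : ℝ) ≤
      Real.exp (d * Λ + 1) * ((2 * Real.pi) ^ d)⁻¹ * volume.real Ω *
        volume.real (Metric.ball (0 : Space d) 1) := by
  classical
  have hf := fun μ : ℝ => finite_eigenspace hd hΩ hfin μ
  let e := fun i => stdOrthonormalBasis ℂ (eigenspace Ω (μ i))
  have ho := (orthogonalFamily_eigenspace hd hΩ hfin hinj).orthonormal_sigma_orthonormal
    (v_family := fun i => e i) fun i => (e i).orthonormal
  have hle := card_le_of_orthonormal hd hΩ hfin (Λ := Λ)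
    (μ := fun j : (Σ i, Fin (Module.finrank ℂ (eigenspace Ω (μ i)))) => μ j.1)
    (fun j => hμ j.1)
    (fun j => isWeakSolution_of_mem_eigenspace hd hΩ hfin (e j.1 j.2).2) ho
  simpa only [Fintype.card_sigma, Fintype.card_fin] using hle

end LogLaplacian

theorem mainTheorem2 (d : ℕ) (hd : 1 ≤ d) (Ω : Set (LogLaplacian.Space d)) (hΩ : IsOpen Ω)
    (hfin : volume Ω < ⊤) (Λ : ℝ) :
    LogLaplacian.counting Ω Λ ≤
      ENNReal.ofReal (Real.exp (d * Λ + 1) * ((2 * Real.pi) ^ d)⁻¹) * volume Ω *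
        volume (Metric.ball (0 : LogLaplacian.Space d) 1) := by
  -- A sum in `ℝ≥0∞` is the supremum of its finite partial sums, so finitely many eigenvalues
  -- suffice.
  rw [LogLaplacian.counting, ENNReal.tsum_eq_iSup_sum]
  refine iSup_le fun s => ?_
  have hm : ∀ μ : ℝ, (LogLaplacian.multiplicity Ω μ : ℝ≥0∞) =
      (Module.finrank ℂ (LogLaplacian.eigenspace Ω μ) : ℝ≥0∞) := fun μ => by
    have := LogLaplacian.finite_eigenspace hd hΩ.measurableSet hfin μ
    rw [LogLaplacian.multiplicity, ← Module.finrank_eq_rank, Cardinal.toENat_nat,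
      ENat.toENNReal_coe]
  have h := ENNReal.ofReal_le_ofReal
    (LogLaplacian.sum_finrank_eigenspace_le hd hΩ.measurableSet hfin
    (μ := fun i : s => ((i : Set.Iio Λ) : ℝ))
    (Subtype.val_injective.comp Subtype.val_injective) fun i => i.1.2)
  rw [Finset.sum_coe_sort s fun i => Module.finrank ℂ (LogLaplacian.eigenspace Ω (i : ℝ))] at h
  rw [ENNReal.ofReal_natCast, ENNReal.ofReal_mul (by positivity),
    ENNReal.ofReal_mul (by positivity), ofReal_measureReal hfin.ne,
    ofReal_measureReal measure_ball_lt_top.ne] at h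
  simpa [hm] using h
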